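/- Let $k$ be an algebraically closed field of characteristic zero and let $H$ be a finite-dimensional semisimple Hopf algebra over $k$ with comultiplication $\Delta(h)=h_1\otimes h_2$ and antipode $S$. A Hopf subalgebra $A\subseteq H$ is called normal if $h_1AS(h_2)\subseteq A$ and $S(h_1)Ah_2\subseteq A$ for all $h\in H$. A Hopf algebra is called simple if it is different from $k$ and its only normal Hopf subalgebras are $k$ and itself. For a family $(K_i)_{i\in I}$ of Hopf subalgebras of $H$ let $\langle K_i\mid i\in I\rangle$ be the Hopf subalgebra generated by them. We say that $H$ is the internal tensor product of the family, written $H=\otimes_{i\in I}K_i$, if every $K_i$ is normal in $H$, $H=\langle K_i\mid i\in I\rangle$, and $K_i\cap\langle K_j\mid j\ne i\rangle=k$ for every $i\in I$. If moreover every $K_i$ is a simple semisimple Hopf algebra, this is called a Krull–Schmidt–Remak type decomposition of $H$. Corollary 4.6. Suppose that $H=\otimes_{i=1}^{r}K_i$ and $H=\otimes_{j=1}^{s}L_j$ are two Krull–Schmidt–Remak type decompositions of $H$. Then $r=s$, and there is a permutation $\sigma$ of $\{1,\dots,r\}$ such that $K_i\cong L_{\sigma(i)}$ as Hopf algebras for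 all $i\in\{1,\dots,r\}$. -/

import Mathlib

open scoped TensorProduct

/-- A Hopf subalgebra `A` of a Hopf algebra `H` over a field `k`: a unital subalgebra with
`Δ(A) ⊆ A ⊗ A` (the image of `A ⊗ A` in `H ⊗ H`) and `S(A) ⊆ A`. -/
structure HopfSubalgebra (k H : Type*) [Field k] [Ring H] [HopfAlgebra k H]
    extends Subalgebra k H where
  comul_mem' : ∀ x ∈ toSubalgebra,
    Bialgebra.comulAlgHom k H x ∈
      (Algebra.TensorProduct.map toSubalgebra.val toSubalgebra.val).range
  antipode_mem' : ∀ x ∈ toSubalgebra, HopfAlgebra.antipode k x ∈ toSubalgebra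

namespace HopfSubalgebra

section HopfStructure

variable {k H : Type*} [Field k] [Ring H] [HopfAlgebra k H] (A : HopfSubalgebra k H)

/-- The inclusion `A → H`. -/
noncomputable def incl : A.toSubalgebra →ₗ[k] H := A.toSubalgebra.val.toLinearMap

theorem incl_apply (x : A.toSubalgebra) : A.incl x = (x : H) := rfl

theorem incl_injective : Function.Injective A.incl := Subtype.val_injective

theorem map_incl_injective : Function.Injective (TensorProduct.map A.incl A.incl) :=
  TensorProduct.map_injective_of_flat_flat _ _ A.incl_injective A.incl_injective

theorem comul_mem_range (x : A.toSubalgebra) :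
    (Coalgebra.comul (R := k) ∘ₗ A.incl) x ∈
      LinearMap.range (TensorProduct.map A.incl A.incl) := by
  obtain ⟨y, hy⟩ := A.comul_mem' x.1 x.2
  exact ⟨y, hy⟩

/-- The comultiplication of `H` restricted to `A → A ⊗ A`. -/
noncomputable def comulRestrict :
    A.toSubalgebra →ₗ[k] A.toSubalgebra ⊗[k] A.toSubalgebra :=
  (LinearEquiv.ofInjective (TensorProduct.map A.incl A.incl) A.map_incl_injective).symm.toLinearMap
    ∘ₗ LinearMap.codRestrict _ (Coalgebra.comul (R := k) ∘ₗ A.incl) A.comul_mem_range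

theorem map_comulRestrict (x : A.toSubalgebra) :
    TensorProduct.map A.incl A.incl (A.comulRestrict x) = Coalgebra.comul (R := k) (x : H) := by
  have h := LinearEquiv.ofInjective_symm_apply (f := TensorProduct.map A.incl A.incl)
    (h := A.map_incl_injective) (LinearMap.codRestrict _ (Coalgebra.comul (R := k) ∘ₗ A.incl)
      A.comul_mem_range x)
  exact h

theorem map_comp_comulRestrict :
    TensorProduct.map A.incl A.incl ∘ₗ A.comulRestrict = Coalgebra.comul (R := k) ∘ₗ A.incl :=
  LinearMap.ext A.map_comulRestrict

noncomputable instance instCoalgebra : Coalgebra k A.toSubalgebra where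
  comul := A.comulRestrict
  counit := Coalgebra.counit (R := k) ∘ₗ A.incl
  coassoc := by
    have hinj : Function.Injective
        (TensorProduct.map A.incl (TensorProduct.map A.incl A.incl)) :=
      TensorProduct.map_injective_of_flat_flat _ _ A.incl_injective A.map_incl_injective
    apply LinearMap.ext
    intro x
    apply hinj
    have h1 : TensorProduct.map A.incl (TensorProduct.map A.incl A.incl) ∘ₗ
        (TensorProduct.assoc k _ _ _).toLinearMap ∘ₗ A.comulRestrict.rTensor _ =
        (TensorProduct.assoc k _ _ _).toLinearMap ∘ₗ
          (Coalgebra.comul (R := k)).rTensor H ∘ₗ TensorProduct.map A.incl A.incl := by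
      rw [LinearMap.rTensor_comp_map, ← A.map_comp_comulRestrict, ← LinearMap.comp_assoc,
        TensorProduct.map_map_comp_assoc_eq, LinearMap.comp_assoc, LinearMap.map_comp_rTensor]
    have h2 : TensorProduct.map A.incl (TensorProduct.map A.incl A.incl) ∘ₗ
        A.comulRestrict.lTensor _ =
          (Coalgebra.comul (R := k)).lTensor H ∘ₗ TensorProduct.map A.incl A.incl := by
      rw [LinearMap.lTensor_comp_map, ← A.map_comp_comulRestrict, LinearMap.map_comp_lTensor]
    have e1 := LinearMap.congr_fun h1 (A.comulRestrict x)
    have e2 := LinearMap.congr_fun h2 (A.comulRestrict x)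
    simp only [LinearMap.comp_apply, A.map_comulRestrict] at e1 e2 ⊢
    rw [e1, e2]
    exact Coalgebra.coassoc_apply (R := k) (x : H)
  rTensor_counit_comp_comul := by
    apply LinearMap.ext
    intro x
    have hinj : Function.Injective (A.incl.lTensor k) :=
      Module.Flat.lTensor_preserves_injective_linearMap _ A.incl_injective
    apply hinj
    have h1 : A.incl.lTensor k ∘ₗ (Coalgebra.counit (R := k) ∘ₗ A.incl).rTensor _ =
        (Coalgebra.counit (R := k)).rTensor H ∘ₗ TensorProduct.map A.incl A.incl := by
      rw [LinearMap.lTensor_comp_rTensor, LinearMap.rTensor_comp_map]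
    have e1 := LinearMap.congr_fun h1 (A.comulRestrict x)
    simp only [LinearMap.comp_apply, A.map_comulRestrict] at e1 ⊢
    rw [e1]
    simp [incl_apply]
  lTensor_counit_comp_comul := by
    apply LinearMap.ext
    intro x
    have hinj : Function.Injective (A.incl.rTensor k) :=
      Module.Flat.rTensor_preserves_injective_linearMap _ A.incl_injective
    apply hinj
    have h1 : A.incl.rTensor k ∘ₗ (Coalgebra.counit (R := k) ∘ₗ A.incl).lTensor _ =
        (Coalgebra.counit (R := k)).lTensor H ∘ₗ TensorProduct.map A.incl A.incl := by
      rw [LinearMap.rTensor_comp_lTensor, LinearMap.lTensor_comp_map]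
    have e1 := LinearMap.congr_fun h1 (A.comulRestrict x)
    simp only [LinearMap.comp_apply, A.map_comulRestrict] at e1 ⊢
    rw [e1]
    simp [incl_apply]

theorem map_comul (x : A.toSubalgebra) :
    TensorProduct.map A.incl A.incl (Coalgebra.comul (R := k) x) =
      Coalgebra.comul (R := k) (x : H) := A.map_comulRestrict x

theorem counit_coe (x : A.toSubalgebra) :
    Coalgebra.counit (R := k) x = Coalgebra.counit (R := k) (x : H) := rfl

theorem map_incl_mul (x y : A.toSubalgebra ⊗[k] A.toSubalgebra) :
    TensorProduct.map A.incl A.incl (x * y) =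
      TensorProduct.map A.incl A.incl x * TensorProduct.map A.incl A.incl y :=
  map_mul (Algebra.TensorProduct.map A.toSubalgebra.val A.toSubalgebra.val) x y

noncomputable instance instBialgebra : Bialgebra k A.toSubalgebra :=
  Bialgebra.mk' k A.toSubalgebra
    (by rw [counit_coe]; exact Bialgebra.counit_one)
    (by intro a b; simp only [counit_coe]; exact Bialgebra.counit_mul _ _)
    (by
      apply A.map_incl_injective
      rw [map_comul]
      exact Bialgebra.comul_one)
    (by
      intro a b
      apply A.map_incl_injective
      rw [map_incl_mul]
      simp only [map_comul]
      exact Bialgebra.comul_mul _ _)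

/-- The antipode of `H` restricted to `A → A`. -/
noncomputable def antipodeRestrict : A.toSubalgebra →ₗ[k] A.toSubalgebra :=
  LinearMap.codRestrict (Subalgebra.toSubmodule A.toSubalgebra)
    (HopfAlgebra.antipode k ∘ₗ A.incl) (fun x => A.antipode_mem' x.1 x.2)

theorem incl_comp_antipodeRestrict :
    A.incl ∘ₗ A.antipodeRestrict = HopfAlgebra.antipode k ∘ₗ A.incl := rfl

theorem incl_comp_mul' :
    A.incl ∘ₗ LinearMap.mul' k A.toSubalgebra =
      LinearMap.mul' k H ∘ₗ TensorProduct.map A.incl A.incl :=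
  TensorProduct.ext' fun _ _ => rfl

/-- A Hopf subalgebra is a Hopf algebra with the restricted structure maps. -/
noncomputable instance instHopfAlgebra : HopfAlgebra k A.toSubalgebra where
  antipode := A.antipodeRestrict
  mul_antipode_rTensor_comul := by
    apply LinearMap.ext
    intro x
    apply A.incl_injective
    have h1 : A.incl ∘ₗ LinearMap.mul' k A.toSubalgebra ∘ₗ A.antipodeRestrict.rTensor _ =
        LinearMap.mul' k H ∘ₗ (HopfAlgebra.antipode k).rTensor H ∘ₗ
          TensorProduct.map A.incl A.incl := by
      rw [← LinearMap.comp_assoc, incl_comp_mul', LinearMap.comp_assoc,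
        LinearMap.map_comp_rTensor, LinearMap.rTensor_comp_map, incl_comp_antipodeRestrict]
    have e1 := LinearMap.congr_fun h1 (Coalgebra.comul (R := k) x)
    simp only [LinearMap.comp_apply, map_comul] at e1 ⊢
    rw [e1]
    exact HopfAlgebra.mul_antipode_rTensor_comul_apply (R := k) (x : H)
  mul_antipode_lTensor_comul := by
    apply LinearMap.ext
    intro x
    apply A.incl_injective
    have h1 : A.incl ∘ₗ LinearMap.mul' k A.toSubalgebra ∘ₗ A.antipodeRestrict.lTensor _ =
        LinearMap.mul' k H ∘ₗ (HopfAlgebra.antipode k).lTensor H ∘ₗ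
          TensorProduct.map A.incl A.incl := by
      rw [← LinearMap.comp_assoc, incl_comp_mul', LinearMap.comp_assoc,
        LinearMap.map_comp_lTensor, LinearMap.lTensor_comp_map, incl_comp_antipodeRestrict]
    have e1 := LinearMap.congr_fun h1 (Coalgebra.comul (R := k) x)
    simp only [LinearMap.comp_apply, map_comul] at e1 ⊢
    rw [e1]
    exact HopfAlgebra.mul_antipode_lTensor_comul_apply (R := k) (x : H)

end HopfStructure

section Normal

variable {k H : Type*} [Field k] [Ring H] [HopfAlgebra k H]

/-- The left adjoint action `h₁ a S(h₂)`. -/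
noncomputable def leftAdjoint (k : Type*) {H : Type*} [Field k] [Ring H] [HopfAlgebra k H]
    (h a : H) : H :=
  LinearMap.mul' k H
    (TensorProduct.map (LinearMap.mulRight k a) (HopfAlgebra.antipode k)
      (Coalgebra.comul (R := k) h))

/-- The right adjoint action `S(h₁) a h₂`. -/
noncomputable def rightAdjoint (k : Type*) {H : Type*} [Field k] [Ring H] [HopfAlgebra k H]
    (h a : H) : H :=
  LinearMap.mul' k H
    (TensorProduct.map (HopfAlgebra.antipode k) (LinearMap.mulLeft k a)
      (Coalgebra.comul (R := k) h))

/-- `A` is normal in `H`: `h₁ A S(h₂) ⊆ A` and `S(h₁) A h₂ ⊆ A` for all `h ∈ H`. -/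
def IsNormal (A : HopfSubalgebra k H) : Prop :=
  ∀ h : H, ∀ a ∈ A.toSubalgebra,
    leftAdjoint k h a ∈ A.toSubalgebra ∧ rightAdjoint k h a ∈ A.toSubalgebra

end Normal

section Generate

variable {k H : Type*} [Field k] [Ring H] [HopfAlgebra k H]

/-- The Hopf subalgebra of `H` generated by a family of Hopf subalgebras; its underlying
algebra is the subalgebra generated by the family. -/
noncomputable def generate {ι : Type*} (K : ι → HopfSubalgebra k H) : HopfSubalgebra k H where
  toSubalgebra := ⨆ i, (K i).toSubalgebra
  comul_mem' := by
    intro x hx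
    have hle : (⨆ i, (K i).toSubalgebra) ≤
        (Algebra.TensorProduct.map (⨆ i, (K i).toSubalgebra).val
          (⨆ i, (K i).toSubalgebra).val).range.comap (Bialgebra.comulAlgHom k H) := by
      refine iSup_le fun i y hy => ?_
      obtain ⟨z, hz⟩ := (K i).comul_mem' y hy
      have hi : (K i).toSubalgebra ≤ ⨆ i, (K i).toSubalgebra :=
        le_iSup (fun i => (K i).toSubalgebra) i
      refine ⟨Algebra.TensorProduct.map (Subalgebra.inclusion hi) (Subalgebra.inclusion hi) z, ?_⟩
      refine Eq.trans ?_ hz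
      exact DFunLike.congr_fun (Algebra.TensorProduct.ext' (fun _ _ => rfl) :
        (Algebra.TensorProduct.map (⨆ i, (K i).toSubalgebra).val
          (⨆ i, (K i).toSubalgebra).val).comp
            (Algebra.TensorProduct.map (Subalgebra.inclusion hi) (Subalgebra.inclusion hi)) =
        Algebra.TensorProduct.map (K i).toSubalgebra.val (K i).toSubalgebra.val) z
    exact hle hx
  antipode_mem' := by
    intro x hx
    refine Algebra.iSup_induction (fun i => (K i).toSubalgebra)
      (motive := fun y => HopfAlgebra.antipode k y ∈ ⨆ i, (K i).toSubalgebra) hx ?_ ?_ ?_ ?_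
    · exact fun i y hy => le_iSup (fun i => (K i).toSubalgebra) i ((K i).antipode_mem' y hy)
    · intro y z hy hz
      rw [map_add]
      exact add_mem hy hz
    · intro y z hy hz
      rw [HopfAlgebra.antipode_mul_antidistrib]
      exact mul_mem hz hy
    · intro c
      rw [Algebra.algebraMap_eq_smul_one, map_smul, HopfAlgebra.antipode_one]
      exact Subalgebra.smul_mem _ (one_mem _) c

theorem generate_le {ι : Type*} (K : ι → HopfSubalgebra k H) (A : HopfSubalgebra k H)
    (h : ∀ i, (K i).toSubalgebra ≤ A.toSubalgebra) :
    (generate K).toSubalgebra ≤ A.toSubalgebra := iSup_le h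

/-- `H` is the internal tensor product of the family `K` of Hopf subalgebras: the `K i` are
normal in `H`, they generate `H`, and `K i ∩ ⟨K j | j ≠ i⟩ = k` for all `i`. -/
structure IsInternalTensorProduct {ι : Type*} (K : ι → HopfSubalgebra k H) : Prop where
  normal : ∀ i, (K i).IsNormal
  generate_eq_top : (generate K).toSubalgebra = ⊤
  inf_eq_bot : ∀ i,
    (K i).toSubalgebra ⊓ (generate fun j : {j : ι // j ≠ i} => K j).toSubalgebra = ⊥

end Generate

end HopfSubalgebra

/-- A Hopf algebra `H` over `k` is simple if `H ≠ k` and its only normal Hopf subalgebras are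
`k` and `H`. -/
def IsSimpleHopfAlgebra (k H : Type*) [Field k] [Ring H] [HopfAlgebra k H] : Prop :=
  (⊤ : Subalgebra k H) ≠ ⊥ ∧
    ∀ A : HopfSubalgebra k H, A.IsNormal → A.toSubalgebra = ⊥ ∨ A.toSubalgebra = ⊤

/-- A decomposition of Krull-Schmidt-Remak type: `H` is the internal tensor product of the
`K i`, and every `K i` is a simple semisimple Hopf algebra. -/
structure IsKrullSchmidtRemakDecomposition {k H : Type*} [Field k] [Ring H] [HopfAlgebra k H]
    {ι : Type*} (K : ι → HopfSubalgebra k H) : Prop where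
  internal : HopfSubalgebra.IsInternalTensorProduct K
  simple : ∀ i, IsSimpleHopfAlgebra k (K i).toSubalgebra
  semisimple : ∀ i, IsSemisimpleRing (K i).toSubalgebra

/-!
A finite-dimensional Hopf algebra has a nonzero right cointegral `l`, given by a trace, and the
form `(x, y) ↦ l(xy)` is nondegenerate. If `f : C → H` is a surjective bialgebra map for which
`l ∘ f` is again a right cointegral, then `f` is injective: with `l(x f(y)) = ε(x)`, each `c` is
recovered as `∑ l(f(c y₁)) S(y₂)`. Let `A` and `B` be elementwise commuting Hopf subalgebras that
generate `H` and satisfy `A ∩ B = k`. The elements `l(a₁ b) a₂ = l(a b₁) S(b₂)` lie in `A ∩ B`,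
which makes the composite of `l` with the multiplication `A ⊗ B → H` a right cointegral. Hence
`A ⊗ B ≃ H`, and `H` projects onto `A` and onto `B`.

Let `A` be simple and let `K` be simple, normal and not contained in `B`. The image of `K` in `A`
is normal and nontrivial, so it is `A`; it follows that `H = K ⊗ B`, and `K ≃ A` by a dimension
count. A factor of one decomposition is contained in the complements of all factors `L j` with
`j ∉ J` only if it is contained in `⟨L j | j ∈ J⟩`, so the factors of one decomposition can be
exchanged one after another for those of the other, as in the Steinitz exchange lemma.
-/

open Coalgebra HopfAlgebra WithConv

section Contraction

variable {R C : Type*} [CommSemiring R] [AddCommMonoid C] [Module R C] [Coalgebra R C]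

/-- The left contraction `c ↦ φ(c₁) c₂` of the comultiplication with a functional `φ`. -/
noncomputable def leftContract : (C →ₗ[R] R) →ₗ[R] C →ₗ[R] C where
  toFun φ := (TensorProduct.lid R C).toLinearMap ∘ₗ φ.rTensor C ∘ₗ comul
  map_add' _ _ := by rw [LinearMap.rTensor_add, LinearMap.add_comp, LinearMap.comp_add]
  map_smul' _ _ := by rw [LinearMap.rTensor_smul, LinearMap.smul_comp, LinearMap.comp_smul]; rfl

/-- The right contraction `c ↦ ψ(c₂) c₁` of the comultiplication with a functional `ψ`. -/
noncomputable def rightContract : (C →ₗ[R] R) →ₗ[R] C →ₗ[R] C where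
  toFun ψ := (TensorProduct.rid R C).toLinearMap ∘ₗ ψ.lTensor C ∘ₗ comul
  map_add' _ _ := by rw [LinearMap.lTensor_add, LinearMap.add_comp, LinearMap.comp_add]
  map_smul' _ _ := by rw [LinearMap.lTensor_smul, LinearMap.smul_comp, LinearMap.comp_smul]; rfl

theorem leftContract_eq_sum {ι : Type*} {c : C} (r : Repr R c ι) (φ : C →ₗ[R] R) :
    leftContract φ c = ∑ i ∈ r.index, φ (r.left i) • r.right i := by
  simp [leftContract, ← r.eq]

theorem rightContract_eq_sum {ι : Type*} {c : C} (r : Repr R c ι) (ψ : C →ₗ[R] R) :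
    rightContract ψ c = ∑ i ∈ r.index, ψ (r.right i) • r.left i := by
  simp [rightContract, ← r.eq]

@[simp]
theorem leftContract_counit : leftContract (counit (R := R) (A := C)) = LinearMap.id := by
  ext c
  simp [leftContract]

@[simp]
theorem rightContract_counit : rightContract (counit (R := R) (A := C)) = LinearMap.id := by
  ext c
  simp [rightContract]

theorem apply_leftContract (φ ψ : C →ₗ[R] R) (c : C) :
    ψ (leftContract φ c) = φ (rightContract ψ c) := by
  simp [leftContract_eq_sum (ℛ R c), rightContract_eq_sum (ℛ R c), mul_comm]

@[simp]
theorem counit_leftContract (φ : C →ₗ[R] R) (c : C) :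
    counit (R := R) (leftContract φ c) = φ c := by
  rw [apply_leftContract, rightContract_counit, LinearMap.id_apply]

theorem comul_rightContract (ψ : C →ₗ[R] R) (c : C) :
    comul (R := R) (rightContract ψ c) = (rightContract ψ).lTensor C (comul c) := by
  have comul_rid : comul ∘ₗ (TensorProduct.rid R C).toLinearMap ∘ₗ ψ.lTensor C =
      (TensorProduct.rid R (C ⊗[R] C)).toLinearMap ∘ₗ ψ.lTensor (C ⊗[R] C) ∘ₗ
        (comul (R := R)).rTensor C := by
    ext; simp
  have rid_assoc : (TensorProduct.rid R (C ⊗[R] C)).toLinearMap ∘ₗ ψ.lTensor (C ⊗[R] C) ∘ₗ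
      (TensorProduct.assoc R C C C).symm.toLinearMap =
        ((TensorProduct.rid R C).toLinearMap ∘ₗ ψ.lTensor C).lTensor C := by
    ext; simp
  calc comul (R := R) (rightContract ψ c)
      = TensorProduct.rid R (C ⊗[R] C) (ψ.lTensor (C ⊗[R] C) (comul.rTensor C (comul c))) :=
        LinearMap.congr_fun comul_rid (comul c)
    _ = ((TensorProduct.rid R C).toLinearMap ∘ₗ ψ.lTensor C).lTensor C
          (comul.lTensor C (comul c)) := by
        rw [← coassoc_symm_apply]
        exact LinearMap.congr_fun rid_assoc (comul.lTensor C (comul c))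
    _ = (rightContract ψ).lTensor C (comul c) := by
        rw [← LinearMap.lTensor_comp_apply]; rfl

theorem leftContract_rightContract (φ ψ : C →ₗ[R] R) (c : C) :
    leftContract φ (rightContract ψ c) = rightContract ψ (leftContract φ c) := by
  calc leftContract φ (rightContract ψ c)
      = TensorProduct.lid R C (φ.rTensor C ((rightContract ψ).lTensor C (comul c))) :=
        congrArg (TensorProduct.lid R C ∘ φ.rTensor C) (comul_rightContract ψ c)
    _ = rightContract ψ (leftContract φ c) := by
        rw [leftContract_eq_sum (ℛ R c), ← (ℛ R c).eq]; simp

theorem rightContract_comp_rightContract (χ ψ : C →ₗ[R] R) :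
    rightContract χ ∘ₗ rightContract ψ = rightContract (ψ ∘ₗ leftContract χ) := by
  ext c
  calc rightContract χ (rightContract ψ c)
      = TensorProduct.rid R C (χ.lTensor C ((rightContract ψ).lTensor C (comul c))) :=
        congrArg (TensorProduct.rid R C ∘ χ.lTensor C) (comul_rightContract ψ c)
    _ = rightContract (ψ ∘ₗ leftContract χ) c := by
        rw [rightContract_eq_sum (ℛ R c), ← (ℛ R c).eq]; simp [apply_leftContract]

end Contraction

section Antipode

open Algebra.TensorProduct

variable {R A : Type*} [CommSemiring R] [Semiring A] [HopfAlgebra R A]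

theorem algHom_convMul_algHom_comp_antipode {D : Type*} [Semiring D] [Algebra R D]
    (f : A →ₐ[R] D) : toConv f.toLinearMap * toConv (f.toLinearMap ∘ₗ antipode R) = 1 := by
  ext c
  simp [(ℛ R c).convMul_apply, ← map_mul, ← map_sum, sum_mul_antipode_eq_algebraMap_counit]

theorem algHom_comp_antipode_convMul_algHom {D : Type*} [Semiring D] [Algebra R D]
    (f : A →ₐ[R] D) : toConv (f.toLinearMap ∘ₗ antipode R) * toConv f.toLinearMap = 1 := by
  ext c
  simp [(ℛ R c).convMul_apply, ← map_mul, ← map_sum, sum_antipode_mul_eq_algebraMap_counit]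

theorem toConv_comul_eq : toConv (comul (R := R) (A := A)) =
    toConv (includeLeft (R := R) (S := R) (A := A) (B := A)).toLinearMap *
      toConv (includeRight (R := R) (A := A) (B := A)).toLinearMap := by
  ext c
  simp [(ℛ R c).convMul_apply, (ℛ R c).eq]

theorem toConv_comul_antipode_eq : toConv (comul (R := R) ∘ₗ antipode R (A := A)) =
    toConv ((includeRight (R := R) (A := A) (B := A)).toLinearMap ∘ₗ antipode R) *
      toConv ((includeLeft (R := R) (S := R) (A := A) (B := A)).toLinearMap ∘ₗ antipode R) := by
  have left_inv : (toConv ((includeRight (R := R) (A := A) (B := A)).toLinearMap ∘ₗ antipode R) *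
      toConv ((includeLeft (R := R) (S := R) (A := A) (B := A)).toLinearMap ∘ₗ antipode R)) *
        toConv (comul (R := R) (A := A)) = 1 := by
    rw [toConv_comul_eq, mul_assoc, ← mul_assoc _ (toConv includeLeft.toLinearMap),
      algHom_comp_antipode_convMul_algHom, one_mul, algHom_comp_antipode_convMul_algHom]
  exact (left_inv_eq_right_inv left_inv
    (algHom_convMul_algHom_comp_antipode (Bialgebra.comulAlgHom R A))).symm

variable {ι : Type*} {c : A}

theorem comul_antipode (r : Repr R c ι) :
    comul (R := R) (antipode R c) =
      ∑ i ∈ r.index, antipode R (r.right i) ⊗ₜ[R] antipode R (r.left i) := by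
  have h := congr(ofConv $(toConv_comul_antipode_eq (R := R) (A := A)) c)
  simpa [r.convMul_apply] using h

theorem sum_comul_mul_one_tmul_antipode (r : Repr R c ι) :
    ∑ i ∈ r.index, comul (R := R) (r.left i) * (1 ⊗ₜ[R] antipode R (r.right i)) = c ⊗ₜ[R] 1 := by
  have h : toConv (comul (R := R) (A := A)) *
      toConv ((includeRight (R := R) (A := A) (B := A)).toLinearMap ∘ₗ antipode R) =
        toConv (includeLeft (R := R) (S := R) (A := A) (B := A)).toLinearMap := by
    rw [toConv_comul_eq, mul_assoc, algHom_convMul_algHom_comp_antipode, mul_one]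
  simpa [r.convMul_apply] using congr(ofConv $h c)

theorem sum_one_tmul_mul_comul_antipode (r : Repr R c ι) :
    ∑ i ∈ r.index, (1 ⊗ₜ[R] r.left i) * comul (R := R) (antipode R (r.right i)) =
      antipode R c ⊗ₜ[R] 1 := by
  have h : toConv (includeRight (R := R) (A := A) (B := A)).toLinearMap *
      toConv (comul (R := R) ∘ₗ antipode R (A := A)) =
        toConv ((includeLeft (R := R) (S := R) (A := A) (B := A)).toLinearMap ∘ₗ antipode R) := by
    rw [toConv_comul_antipode_eq, ← mul_assoc, algHom_convMul_algHom_comp_antipode, one_mul]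
  simpa [r.convMul_apply] using congr(ofConv $h c)

end Antipode

section Cointegral

variable {k B : Type*} [CommRing k] [Ring B] [HopfAlgebra k B]

theorem leftContract_comp_mulLeft (φ : B →ₗ[k] k) (a x : B) :
    leftContract (φ ∘ₗ LinearMap.mulLeft k a) x =
      TensorProduct.lid k B (φ.rTensor B ((a ⊗ₜ[k] 1) * comul x)) := by
  simp [leftContract_eq_sum (ℛ k x), ← (ℛ k x).eq, Finset.mul_sum]

theorem leftContract_comp_mulRight (φ : B →ₗ[k] k) (a x : B) :
    leftContract (φ ∘ₗ LinearMap.mulRight k a) x =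
      TensorProduct.lid k B (φ.rTensor B (comul x * (a ⊗ₜ[k] 1))) := by
  simp [leftContract_eq_sum (ℛ k x), ← (ℛ k x).eq, Finset.sum_mul]

theorem mul_leftContract (φ : B →ₗ[k] k) (a x : B) :
    a * leftContract φ x = TensorProduct.lid k B (φ.rTensor B ((1 ⊗ₜ[k] a) * comul x)) := by
  simp [leftContract_eq_sum (ℛ k x), ← (ℛ k x).eq, Finset.mul_sum]

theorem leftContract_mul (φ : B →ₗ[k] k) (a x : B) :
    leftContract φ x * a = TensorProduct.lid k B (φ.rTensor B (comul x * (1 ⊗ₜ[k] a))) := by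
  simp [leftContract_eq_sum (ℛ k x), ← (ℛ k x).eq, Finset.sum_mul]

theorem rightContract_comp_mulLeft (ψ : B →ₗ[k] k) (a x : B) :
    rightContract (ψ ∘ₗ LinearMap.mulLeft k a) x =
      TensorProduct.rid k B (ψ.lTensor B ((1 ⊗ₜ[k] a) * comul x)) := by
  simp [rightContract_eq_sum (ℛ k x), ← (ℛ k x).eq, Finset.mul_sum]

theorem mul_rightContract (ψ : B →ₗ[k] k) (a x : B) :
    a * rightContract ψ x = TensorProduct.rid k B (ψ.lTensor B ((a ⊗ₜ[k] 1) * comul x)) := by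
  simp [rightContract_eq_sum (ℛ k x), ← (ℛ k x).eq, Finset.mul_sum]

/-- A right cointegral of `B`: a functional `l` with `l(x₁) x₂ = l(x) 1`, i.e. a right integral of
the dual algebra. -/
def IsRightCointegral (l : B →ₗ[k] k) : Prop :=
  ∀ x, leftContract l x = algebraMap k B (l x)

namespace IsRightCointegral

variable {l : B →ₗ[k] k} {ι : Type*}

theorem leftContract_comp_mulRight (hl : IsRightCointegral l) (x : B) {y : B} (r : Repr k y ι) :
    leftContract (l ∘ₗ LinearMap.mulRight k y) x =
      ∑ i ∈ r.index, l (x * r.left i) • antipode k (r.right i) := by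
  rw [_root_.leftContract_comp_mulRight, ← sum_comul_mul_one_tmul_antipode r, Finset.mul_sum]
  simp only [← mul_assoc, ← Bialgebra.comul_mul, map_sum, ← leftContract_mul, hl _,
    Algebra.smul_def]

theorem leftContract_comp_mulLeft (hl : IsRightCointegral l) (x : B) {y : B} (r : Repr k y ι) :
    leftContract (l ∘ₗ LinearMap.mulLeft k (antipode k y)) x =
      ∑ i ∈ r.index, l (antipode k (r.right i) * x) • r.left i := by
  rw [_root_.leftContract_comp_mulLeft, ← sum_one_tmul_mul_comul_antipode r, Finset.sum_mul]
  simp only [mul_assoc, ← Bialgebra.comul_mul, map_sum, ← mul_leftContract, hl _,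
    Algebra.smul_def, Algebra.commutes]

end IsRightCointegral

theorem antipode_antipode_mul_rightContract {ι : Type*} {c : B} (r : Repr k c ι)
    (ψ : B →ₗ[k] k) (x : B) :
    antipode k (antipode k c) * rightContract ψ x =
      ∑ i ∈ r.index, rightContract (ψ ∘ₗ LinearMap.mulLeft k (antipode k (r.right i)))
        (antipode k (antipode k (r.left i)) * x) := by
  have h := sum_one_tmul_mul_comul_antipode (R := k)
    ⟨r.index, fun i ↦ antipode k (r.right i), fun i ↦ antipode k (r.left i),
      (comul_antipode r).symm⟩
  rw [mul_rightContract, ← h, Finset.sum_mul]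
  simp only [mul_assoc, ← Bialgebra.comul_mul, map_sum, rightContract_comp_mulLeft]

/-- The functional `x ↦ Tr(c ↦ φ(c₁) S²(c₂) x)`, which is a right cointegral of a finite
free Hopf algebra for every functional `φ`. -/
noncomputable def traceCointegral (φ : B →ₗ[k] k) : B →ₗ[k] k :=
  LinearMap.trace k B ∘ₗ
    LinearMap.lcomp k B (antipode k ∘ₗ antipode k ∘ₗ leftContract φ) ∘ₗ (LinearMap.mul k B).flip

theorem traceCointegral_apply (φ : B →ₗ[k] k) (x : B) :
    traceCointegral φ x = LinearMap.trace k B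
      (LinearMap.mulRight k x * antipode k * antipode k * leftContract φ) :=
  rfl

variable {ι : Type*} [Fintype ι] (u : Module.Basis ι k B)

theorem sum_rightContract_coord_mul_rightContract (ψ : B →ₗ[k] k) :
    ∑ j, rightContract (u.coord j) *
      rightContract (ψ ∘ₗ LinearMap.mulLeft k (antipode k (u j))) = ψ 1 • 1 := by
  have h : ∑ j, ψ ∘ₗ LinearMap.mulLeft k (antipode k (u j)) ∘ₗ leftContract (u.coord j) =
      ψ 1 • counit := by
    ext c
    calc (∑ j, ψ ∘ₗ LinearMap.mulLeft k (antipode k (u j)) ∘ₗ leftContract (u.coord j)) c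
        = ψ (∑ i ∈ (ℛ k c).index,
            antipode k (∑ j, u.coord j ((ℛ k c).left i) • u j) * (ℛ k c).right i) := by
          simp only [LinearMap.sum_apply, LinearMap.comp_apply, leftContract_eq_sum (ℛ k c),
            map_sum, map_smul, LinearMap.mulLeft_apply, Finset.sum_mul, smul_mul_assoc]
          exact Finset.sum_comm
      _ = (ψ 1 • counit (R := k)) c := by
          simp [u.sum_repr, sum_antipode_mul_eq_algebraMap_counit,
            Algebra.algebraMap_eq_smul_one, mul_comm]
  simp only [Module.End.mul_eq_comp, rightContract_comp_rightContract, LinearMap.comp_assoc]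
  rw [← map_sum, h, map_smul, rightContract_counit]
  rfl

theorem mulRight_rightContract_mul_antipode_mul_antipode (ψ : B →ₗ[k] k) (x : B) :
    LinearMap.mulRight k (rightContract ψ x) * antipode k * antipode k =
      ∑ j, rightContract (ψ ∘ₗ LinearMap.mulLeft k (antipode k (u j))) *
        (LinearMap.mulRight k x * antipode k * antipode k * rightContract (u.coord j)) := by
  ext c
  let Ψ : B →ₗ[k] B →ₗ[k] k := (LinearMap.mul k B).compr₂ ψ
  have hΨ (a : B) : ψ ∘ₗ LinearMap.mulLeft k a = Ψ a := rfl
  calc antipode k (antipode k c) * rightContract ψ x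
      = ∑ i ∈ (ℛ k c).index, rightContract (Ψ
          (antipode k (∑ j, u.coord j ((ℛ k c).right i) • u j)))
            (antipode k (antipode k ((ℛ k c).left i)) * x) := by
        simp only [antipode_antipode_mul_rightContract (ℛ k c), Module.Basis.coord_apply,
          u.sum_repr, hΨ]
    _ = _ := by
        simp only [hΨ, map_sum, map_smul, LinearMap.sum_apply, LinearMap.smul_apply,
          Module.End.mul_apply, rightContract_eq_sum (ℛ k c), LinearMap.mulRight_apply]
        exact Finset.sum_comm

theorem traceCointegral_rightContract [Module.Finite k B] [Module.Free k B]
    (φ ψ : B →ₗ[k] k) (x : B) :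
    traceCointegral φ (rightContract ψ x) = ψ 1 * traceCointegral φ x := by
  let u := Module.Free.chooseBasis k B
  let T := LinearMap.mulRight k x * antipode k * antipode k
  let D (j) := rightContract (ψ ∘ₗ LinearMap.mulLeft k (antipode k (u j)))
  have contract_comm (χ : B →ₗ[k] k) : Commute (leftContract φ) (rightContract χ) :=
    LinearMap.ext (leftContract_rightContract φ χ)
  calc traceCointegral φ (rightContract ψ x)
      = ∑ j, LinearMap.trace k B (D j * (T * rightContract (u.coord j) * leftContract φ)) := by
        rw [traceCointegral_apply, mulRight_rightContract_mul_antipode_mul_antipode u,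
          Finset.sum_mul, map_sum]
        simp only [mul_assoc, T, D]
    _ = ∑ j, LinearMap.trace k B (T * leftContract φ * (rightContract (u.coord j) * D j)) := by
        refine Finset.sum_congr rfl fun j _ ↦ ?_
        rw [LinearMap.trace_mul_comm, mul_assoc T, ← (contract_comm _).eq]
        simp only [mul_assoc]
    _ = ψ 1 * traceCointegral φ x := by
        rw [← map_sum, ← Finset.mul_sum, sum_rightContract_coord_mul_rightContract, mul_smul_comm,
          mul_one, map_smul, traceCointegral_apply, smul_eq_mul]

theorem isRightCointegral_traceCointegral [Module.Finite k B] [Module.Free k B]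
    (φ : B →ₗ[k] k) : IsRightCointegral (traceCointegral φ) := by
  intro x
  refine (Module.Free.chooseBasis k B).ext_elem fun i ↦ ?_
  rw [← Module.Basis.coord_apply, ← Module.Basis.coord_apply, apply_leftContract,
    traceCointegral_rightContract, Algebra.algebraMap_eq_smul_one, map_smul, smul_eq_mul, mul_comm]

theorem sum_traceCointegral_coord_antipode :
    ∑ j, traceCointegral (u.coord j) (antipode k (u j)) = 1 := by
  have h : ∑ j, LinearMap.mulRight k (antipode k (u j)) * antipode k * antipode k *
      leftContract (u.coord j) = (counit (R := k)).smulRight (1 : B) := by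
    ext c
    calc (∑ j, LinearMap.mulRight k (antipode k (u j)) * antipode k * antipode k *
          leftContract (u.coord j) : Module.End k B) c
        = ∑ i ∈ (ℛ k c).index, antipode k (antipode k ((ℛ k c).right i)) *
            antipode k (∑ j, u.coord j ((ℛ k c).left i) • u j) := by
          simp only [LinearMap.sum_apply, Module.End.mul_apply, leftContract_eq_sum (ℛ k c),
            map_sum, map_smul, LinearMap.mulRight_apply, Finset.mul_sum, mul_smul_comm]
          exact Finset.sum_comm
      _ = antipode k (∑ i ∈ (ℛ k c).index, (ℛ k c).left i * antipode k ((ℛ k c).right i)) := by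
          simp [u.sum_repr, antipode_mul_antidistrib]
      _ = (counit (R := k)).smulRight (1 : B) c := by
          rw [sum_mul_antipode_eq_algebraMap_counit]
          simp [Algebra.algebraMap_eq_smul_one]
  have := Module.Finite.of_basis u
  have := Module.Free.of_basis u
  simp only [traceCointegral_apply, ← map_sum]
  rw [h, LinearMap.trace_smulRight, Bialgebra.counit_one]

end Cointegral

section Nondegenerate

variable {k B : Type*} [Field k] [Ring B] [HopfAlgebra k B]

theorem eq_bot_or_one_mem_of_leftContract_mem (I : Submodule B B)
    (hI : ∀ (χ : B →ₗ[k] k), ∀ b ∈ I, leftContract χ b ∈ I) : I = ⊥ ∨ (1 : B) ∈ I := by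
  by_cases hε : ∃ b ∈ I, counit (R := k) b ≠ 0
  · obtain ⟨b, hb, hεb⟩ := hε
    let u := Module.Basis.ofVectorSpace k B
    obtain ⟨c, hc⟩ := TensorProduct.eq_repr_basis_left u (comul (R := k) b)
    have leftContract_coord (i) : leftContract (u.coord i) b = c i := by
      classical
      simpa [leftContract, ← hc, Finsupp.sum, Finsupp.single_apply] using Eq.symm
    have c_mem (i) : c i ∈ I := leftContract_coord i ▸ hI (u.coord i) b hb
    have sum_mem : ∑ i ∈ c.support, antipode k (u i) * c i ∈ I :=
      I.sum_mem fun i _ ↦ I.smul_mem _ (c_mem i)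
    have sum_eq : ∑ i ∈ c.support, antipode k (u i) * c i = algebraMap k B (counit b) := by
      rw [← mul_antipode_rTensor_comul_apply, ← hc]
      simp [Finsupp.sum]
    right
    rw [sum_eq] at sum_mem
    simpa [Algebra.smul_def, ← map_mul, hεb] using
      I.smul_mem (algebraMap k B (counit b)⁻¹) sum_mem
  · push Not at hε
    refine .inl ((Submodule.eq_bot_iff I).2 fun b hb ↦ ?_)
    refine (Module.forall_dual_apply_eq_zero_iff k b).1 fun χ ↦ ?_
    rw [← counit_leftContract, hε _ (hI χ b hb)]

theorem IsRightCointegral.eq_zero_of_forall_antipode_mul {l : B →ₗ[k] k}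
    (hl : IsRightCointegral l) (hne : l ≠ 0) {b : B} (hb : ∀ x, l (antipode k b * x) = 0) :
    b = 0 := by
  let N : Submodule B B :=
    { carrier := {b | ∀ x, l (antipode k b * x) = 0}
      add_mem' := fun ha hb x ↦ by rw [map_add, add_mul, map_add, ha, hb, add_zero]
      zero_mem' := fun x ↦ by rw [map_zero, zero_mul, map_zero]
      smul_mem' := fun a b hb x ↦ by
        rw [smul_eq_mul, antipode_mul_antidistrib, mul_assoc, hb] }
  have leftContract_mem (χ : B →ₗ[k] k) (b : B) (hb : b ∈ N) : leftContract χ b ∈ N := by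
    intro x
    have h : leftContract (l ∘ₗ LinearMap.mulLeft k (antipode k b)) x = 0 := by
      rw [show l ∘ₗ LinearMap.mulLeft k (antipode k b) = 0 from LinearMap.ext hb, map_zero,
        LinearMap.zero_apply]
    rw [hl.leftContract_comp_mulLeft x (ℛ k b)] at h
    simpa [leftContract_eq_sum (ℛ k b), Finset.sum_mul, mul_comm] using congrArg χ h
  have one_notMem : (1 : B) ∉ N := fun h ↦ hne (LinearMap.ext fun x ↦ by simpa using h x)
  exact (Submodule.eq_bot_iff N).1
    ((eq_bot_or_one_mem_of_leftContract_mem N leftContract_mem).resolve_right one_notMem) b hb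

variable [Module.Finite k B]

theorem IsRightCointegral.exists_apply_mul_eq {l : B →ₗ[k] k} (hl : IsRightCointegral l)
    (hne : l ≠ 0) (φ : B →ₗ[k] k) : ∃ e, ∀ x, l (x * e) = φ x := by
  let β : B →ₗ[k] B →ₗ[k] k := (LinearMap.mul k B).compr₂ l
  have finrank_dual : Module.finrank k B = Module.finrank k (B →ₗ[k] k) :=
    (Subspace.dual_finrank_eq (K := k) (V := B)).symm
  have β_antipode_injective : Function.Injective (β ∘ₗ antipode k) :=
    (injective_iff_map_eq_zero _).2 fun b hb ↦
      hl.eq_zero_of_forall_antipode_mul hne (LinearMap.congr_fun hb)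
  have β_surjective : Function.Surjective β :=
    .of_comp (g := antipode k)
      ((LinearMap.injective_iff_surjective_of_finrank_eq_finrank (f := β ∘ₗ antipode k)
        finrank_dual).1 β_antipode_injective)
  have flip_injective : Function.Injective β.flip :=
    (injective_iff_map_eq_zero _).2 fun e he ↦
      (Module.forall_dual_apply_eq_zero_iff k e).1 fun φ ↦ by
        obtain ⟨a, rfl⟩ := β_surjective φ
        exact LinearMap.congr_fun he a
  obtain ⟨e, he⟩ := (LinearMap.injective_iff_surjective_of_finrank_eq_finrank finrank_dual).1
    flip_injective φ
  exact ⟨e, LinearMap.congr_fun he⟩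

variable (k B) in
theorem exists_isRightCointegral_ne_zero : ∃ l : B →ₗ[k] k, IsRightCointegral l ∧ l ≠ 0 := by
  by_contra! h
  have sum_eq := sum_traceCointegral_coord_antipode (Module.finBasis k B)
  simp [h _ (isRightCointegral_traceCointegral _)] at sum_eq

end Nondegenerate

section Injective

variable {k A B : Type*} [Field k] [Ring A] [HopfAlgebra k A] [Ring B] [HopfAlgebra k B]

theorem injective_of_isRightCointegral_comp [Module.Finite k B] (f : A →ₐc[k] B)
    (hf : Function.Surjective f) {l : B →ₗ[k] k} (hl : IsRightCointegral l) (hne : l ≠ 0)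
    (hlf : IsRightCointegral (l ∘ₗ (f : A →ₗ[k] B))) : Function.Injective f := by
  obtain ⟨e, he⟩ := hl.exists_apply_mul_eq hne counit
  obtain ⟨y, rfl⟩ := hf e
  refine (injective_iff_map_eq_zero f).2 fun x hx ↦ ?_
  have comp_mulRight : (l ∘ₗ (f : A →ₗ[k] B)) ∘ₗ LinearMap.mulRight k y = counit := by
    ext a
    simp [he]
  calc x = leftContract ((l ∘ₗ (f : A →ₗ[k] B)) ∘ₗ LinearMap.mulRight k y) x := by
        rw [comp_mulRight, leftContract_counit, LinearMap.id_apply]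
    _ = ∑ i ∈ (ℛ k y).index, l (f (x * (ℛ k y).left i)) • antipode k ((ℛ k y).right i) :=
        hlf.leftContract_comp_mulRight x (ℛ k y)
    _ = 0 := by simp [hx]

end Injective

section BialgHom

variable {k A B : Type*} [CommSemiring k] [Semiring A] [HopfAlgebra k A] [Semiring B]
  [HopfAlgebra k B]

theorem bialgHom_map_antipode (f : A →ₐc[k] B) (x : A) :
    f (antipode k x) = antipode k (f x) := by
  let f' : A →ₐ[k] B := f
  have left_inv : toConv (f'.toLinearMap ∘ₗ antipode k) * toConv f'.toLinearMap = 1 :=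
    algHom_comp_antipode_convMul_algHom f'
  have right_inv : toConv f'.toLinearMap * toConv (antipode k ∘ₗ f'.toLinearMap) = 1 := by
    ext y
    rw [(ℛ k y).convMul_apply]
    exact sum_mul_antipode_eq_algebraMap_counit ((ℛ k y).induced f) |>.trans
      (congrArg _ (CoalgHomClass.counit_comp_apply f y))
  exact congrArg (fun F : WithConv (A →ₗ[k] B) ↦ F x) (left_inv_eq_right_inv left_inv right_inv)

end BialgHom

theorem exists_linearProjection_mem {k V : Type*} [Field k] [AddCommGroup V] [Module k V]
    (p q : Submodule k V) : ∃ π : V →ₗ[k] p, (∀ x : p, π x = x) ∧ ∀ x ∈ q, (π x : V) ∈ q := by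
  obtain ⟨c, hc⟩ := (p ⊓ q).exists_isCompl
  have disjoint : Disjoint p (c ⊓ q) := by
    rw [disjoint_iff, inf_left_comm, inf_comm, hc.inf_eq_bot]
  have sup_eq : p ⊓ q ⊔ c ⊓ q = q := by
    rw [← sup_inf_assoc_of_le c inf_le_right, hc.sup_eq_top, top_inf_eq]
  obtain ⟨d, hd, isCompl⟩ := disjoint.symm.exists_isCompl
  refine ⟨p.projectionOnto d isCompl.symm, fun x ↦ by simp, fun x hx ↦ ?_⟩
  obtain ⟨y, hy, z, hz, rfl⟩ := Submodule.mem_sup.1 (sup_eq.ge hx)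
  simpa [Submodule.projectionOnto_apply_of_mem_left isCompl.symm hy.1,
    Submodule.projectionOnto_apply_of_mem_right isCompl.symm (hd hz)] using hy.2

namespace HopfSubalgebra

variable {k H X : Type*} [Field k] [Ring H] [HopfAlgebra k H] [Ring X] [HopfAlgebra k X]

/-- The inclusion of a Hopf subalgebra as a bialgebra homomorphism. -/
noncomputable def inclBialgHom (A : HopfSubalgebra k H) : A.toSubalgebra →ₐc[k] H :=
  BialgHom.ofAlgHom A.toSubalgebra.val (by ext; rfl) (AlgHom.ext A.map_comul)

@[simp]
theorem inclBialgHom_apply (A : HopfSubalgebra k H) (x : A.toSubalgebra) :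
    A.inclBialgHom x = x := rfl

theorem exists_repr (A : HopfSubalgebra k H) {x : H} (hx : x ∈ A.toSubalgebra) :
    ∃ r : Repr k x (A.toSubalgebra × A.toSubalgebra),
      (∀ i, r.left i ∈ A.toSubalgebra) ∧ ∀ i, r.right i ∈ A.toSubalgebra :=
  ⟨(ℛ k (⟨x, hx⟩ : A.toSubalgebra)).induced A.inclBialgHom, fun _ ↦ Subtype.property _,
    fun _ ↦ Subtype.property _⟩

theorem eq_algebraMap_counit_of_mem_bot {x : H} (hx : x ∈ (⊥ : Subalgebra k H)) :
    x = algebraMap k H (counit x) := by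
  obtain ⟨c, rfl⟩ := Algebra.mem_bot.1 hx
  rw [Bialgebra.counit_algebraMap]

section Adjoint

variable {ι κ : Type*} {h a b : H}

theorem leftAdjoint_eq_sum (r : Repr k h ι) (a : H) :
    leftAdjoint k h a = ∑ i ∈ r.index, r.left i * a * antipode k (r.right i) := by
  simp [leftAdjoint, ← r.eq]

theorem rightAdjoint_eq_sum (r : Repr k h ι) (a : H) :
    rightAdjoint k h a = ∑ i ∈ r.index, antipode k (r.left i) * (a * r.right i) := by
  simp [rightAdjoint, ← r.eq]

theorem counit_leftAdjoint (h a : H) :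
    counit (R := k) (leftAdjoint k h a) = counit (R := k) h * counit (R := k) a := by
  rw [leftAdjoint_eq_sum (ℛ k h)]
  conv_rhs => rw [← sum_counit_smul (ℛ k h)]
  simp [Finset.sum_mul, mul_right_comm]

theorem leftAdjoint_mul (g h a : H) :
    leftAdjoint k (g * h) a = leftAdjoint k g (leftAdjoint k h a) := by
  rw [leftAdjoint_eq_sum ((ℛ k g).mul (ℛ k h)), leftAdjoint_eq_sum (ℛ k g),
    leftAdjoint_eq_sum (ℛ k h)]
  simp [Repr.mul, Finset.mul_sum, Finset.sum_mul, Finset.sum_product,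
    antipode_mul_antidistrib, mul_assoc]

theorem rightAdjoint_mul (g h a : H) :
    rightAdjoint k (g * h) a = rightAdjoint k h (rightAdjoint k g a) := by
  rw [rightAdjoint_eq_sum ((ℛ k g).mul (ℛ k h)), rightAdjoint_eq_sum (ℛ k g),
    rightAdjoint_eq_sum (ℛ k h)]
  simp [Repr.mul, Finset.mul_sum, Finset.sum_mul, Finset.sum_product_right,
    antipode_mul_antidistrib, mul_assoc]

theorem leftAdjoint_of_commute (r : Repr k h ι) (hr : ∀ i, Commute (r.left i) a) :
    leftAdjoint k h a = counit (R := k) h • a := by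
  simp only [leftAdjoint_eq_sum r, (hr _).eq, mul_assoc, ← Finset.mul_sum,
    sum_mul_antipode_eq_smul r, mul_smul_comm, mul_one]

theorem rightAdjoint_of_commute (r : Repr k h ι) (hr : ∀ i, Commute (r.right i) a) :
    rightAdjoint k h a = counit (R := k) h • a := by
  simp only [rightAdjoint_eq_sum r, ← (hr _).eq, ← mul_assoc, ← Finset.sum_mul,
    sum_antipode_mul_eq_smul r, smul_mul_assoc, one_mul]

theorem map_leftAdjoint (f : H →ₐc[k] X) (h a : H) :
    f (leftAdjoint k h a) = leftAdjoint k (f h) (f a) := by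
  simp [leftAdjoint_eq_sum (ℛ k h), leftAdjoint_eq_sum ((ℛ k h).induced f), bialgHom_map_antipode]

theorem map_rightAdjoint (f : H →ₐc[k] X) (h a : H) :
    f (rightAdjoint k h a) = rightAdjoint k (f h) (f a) := by
  simp [rightAdjoint_eq_sum (ℛ k h), rightAdjoint_eq_sum ((ℛ k h).induced f),
    bialgHom_map_antipode]

theorem sum_leftAdjoint_mul_antipode (r : Repr k a ι) (t : Repr k b κ) :
    ∑ j ∈ t.index, leftAdjoint k a (t.left j) * antipode k (t.right j) =
      ∑ i ∈ r.index, r.left i * leftAdjoint k b (antipode k (r.right i)) := by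
  simp only [leftAdjoint_eq_sum r, leftAdjoint_eq_sum t, Finset.sum_mul, Finset.mul_sum, mul_assoc]
  exact Finset.sum_comm

end Adjoint

section Commute

variable {A B : HopfSubalgebra k H}

theorem sum_leftAdjoint_mul_antipode_of_isNormal (hA : A.IsNormal) (hB : B.IsNormal)
    (h : A.toSubalgebra ⊓ B.toSubalgebra = ⊥) (a : A.toSubalgebra) (b : B.toSubalgebra)
    {κ : Type*} (t : Repr k b κ) :
    ∑ j ∈ t.index, leftAdjoint k (a : H) (t.left j) * antipode k (t.right j : H) =
      algebraMap k H (counit (R := k) a * counit (R := k) b) := by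
  obtain ⟨r, hr_left, hr_right⟩ := A.exists_repr a.2
  have mem_inf : ∑ j ∈ t.index, leftAdjoint k (a : H) (t.left j) * antipode k (t.right j : H) ∈
      A.toSubalgebra ⊓ B.toSubalgebra := by
    constructor
    · refine (sum_leftAdjoint_mul_antipode r (t.induced B.inclBialgHom)).symm ▸ ?_
      exact sum_mem fun i _ ↦ mul_mem (hr_left i) (hA _ _ (A.antipode_mem' _ (hr_right i))).1
    · exact sum_mem fun j _ ↦ mul_mem (hB _ _ (t.left j).2).1 (B.antipode_mem' _ (t.right j).2)
  rw [h] at mem_inf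
  rw [eq_algebraMap_counit_of_mem_bot mem_inf]
  conv_rhs => rw [← sum_counit_smul t]
  simp [counit_leftAdjoint, Finset.mul_sum, mul_assoc, counit_coe]

-- The maps `a ⊗ b ↦ a b` and `a ⊗ b ↦ b a` are both convolution inverse to `a ⊗ b ↦ S(a) S(b)`.
theorem commute_of_isNormal (hA : A.IsNormal) (hB : B.IsNormal)
    (h : A.toSubalgebra ⊓ B.toSubalgebra = ⊥) (a : A.toSubalgebra) (b : B.toSubalgebra) :
    Commute (a : H) (b : H) := by
  let m := LinearMap.mul' k H ∘ₗ TensorProduct.map A.incl B.incl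
  let mop := LinearMap.mul' k H ∘ₗ (TensorProduct.comm k H H).toLinearMap ∘ₗ
    TensorProduct.map A.incl B.incl
  let s := LinearMap.mul' k H ∘ₗ TensorProduct.map (antipode k ∘ₗ A.incl) (antipode k ∘ₗ B.incl)
  have left_inv : toConv m * toConv s = 1 := by
    ext a b
    have leftAdjoint_eq : ∀ y, leftAdjoint k (a : H) y = ∑ i ∈ (ℛ k a).index,
        ((ℛ k a).left i : H) * y * antipode k ((ℛ k a).right i : H) :=
      leftAdjoint_eq_sum ((ℛ k a).induced A.inclBialgHom)
    calc (toConv m * toConv s) (a ⊗ₜ b)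
        = ∑ j ∈ (ℛ k b).index,
            leftAdjoint k (a : H) ((ℛ k b).left j) * antipode k ((ℛ k b).right j : H) := by
          rw [((ℛ k a).tmul (ℛ k b)).convMul_apply]
          simp [m, s, Repr.tmul, incl_apply, leftAdjoint_eq, Finset.sum_product_right,
            Finset.sum_mul, mul_assoc]
      _ = algebraMap k H (counit (R := k) (a ⊗ₜ[k] b)) := by
          rw [sum_leftAdjoint_mul_antipode_of_isNormal hA hB h, TensorProduct.counit_tmul,
            smul_eq_mul, mul_comm]
  have right_inv : toConv s * toConv mop = 1 := by
    ext a b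
    have sum_eq := sum_antipode_mul_eq_algebraMap_counit
      (((ℛ k b).induced B.inclBialgHom).mul ((ℛ k a).induced A.inclBialgHom))
    change (toConv s * toConv mop) (a ⊗ₜ b) = algebraMap k H (counit (R := k) (a ⊗ₜ[k] b))
    rw [((ℛ k a).tmul (ℛ k b)).convMul_apply]
    simp only [Repr.tmul, Finset.sum_product_right]
    simpa [mop, s, Repr.mul, Repr.tmul, incl_apply, counit_coe, antipode_mul_antidistrib,
      Finset.sum_product] using sum_eq
  exact congrArg (fun F : WithConv (A.toSubalgebra ⊗[k] B.toSubalgebra →ₗ[k] H) ↦ F (a ⊗ₜ b))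
    (left_inv_eq_right_inv left_inv right_inv)

end Commute

section Functoriality

/-- The image of a Hopf subalgebra under a bialgebra homomorphism. -/
noncomputable def map (f : H →ₐc[k] X) (A : HopfSubalgebra k H) : HopfSubalgebra k X where
  toSubalgebra := A.toSubalgebra.map (f : H →ₐ[k] X)
  comul_mem' := by
    rintro _ ⟨x, hx, rfl⟩
    obtain ⟨r, hr_left, hr_right⟩ := A.exists_repr hx
    change comul (R := k) (f x) ∈ _
    rw [← (r.induced f).eq]
    exact sum_mem fun i _ ↦ ⟨⟨_, _, hr_left i, rfl⟩ ⊗ₜ ⟨_, _, hr_right i, rfl⟩, rfl⟩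
  antipode_mem' := by
    rintro _ ⟨x, hx, rfl⟩
    exact ⟨_, A.antipode_mem' x hx, bialgHom_map_antipode f x⟩

theorem IsNormal.map {f : H →ₐc[k] X} (hf : Function.Surjective f) {A : HopfSubalgebra k H}
    (hA : A.IsNormal) : (A.map f).IsNormal := by
  rintro h _ ⟨x, hx, rfl⟩
  obtain ⟨h, rfl⟩ := hf h
  exact ⟨⟨_, (hA h x hx).1, map_leftAdjoint f h x⟩, ⟨_, (hA h x hx).2, map_rightAdjoint f h x⟩⟩

/-- The intersection of `M` with `A`, as a Hopf subalgebra of `A`. -/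
noncomputable def restrict (M A : HopfSubalgebra k H) : HopfSubalgebra k A.toSubalgebra where
  toSubalgebra := M.toSubalgebra.comap A.toSubalgebra.val
  comul_mem' := by
    intro x hx
    obtain ⟨π, hπ, hπ_mem⟩ := exists_linearProjection_mem (Subalgebra.toSubmodule A.toSubalgebra)
      (Subalgebra.toSubmodule M.toSubalgebra)
    obtain ⟨r, hr_left, hr_right⟩ := M.exists_repr (x := x) hx
    have comul_eq : comul (R := k) x = ∑ i ∈ r.index, π (r.left i) ⊗ₜ[k] π (r.right i) := by
      have π_comp_incl : π ∘ₗ A.incl = .id := LinearMap.ext hπ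
      calc comul (R := k) x
          = TensorProduct.map π π (TensorProduct.map A.incl A.incl (comul x)) := by
            rw [← LinearMap.comp_apply, ← TensorProduct.map_comp, π_comp_incl,
              TensorProduct.map_id, LinearMap.id_apply]
        _ = ∑ i ∈ r.index, π (r.left i) ⊗ₜ[k] π (r.right i) := by
            rw [map_comul, ← r.eq]
            simp
    change comul (R := k) x ∈ _
    rw [comul_eq]
    exact sum_mem fun i _ ↦ ⟨⟨_, hπ_mem _ (hr_left i)⟩ ⊗ₜ ⟨_, hπ_mem _ (hr_right i)⟩, rfl⟩
  antipode_mem' x hx := M.antipode_mem' _ hx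

theorem IsNormal.restrict {M : HopfSubalgebra k H} (hM : M.IsNormal) (A : HopfSubalgebra k H) :
    (M.restrict A).IsNormal := fun h a ha ↦
  ⟨((map_leftAdjoint A.inclBialgHom h a).symm ▸ (hM h a ha).1 :
      A.inclBialgHom (leftAdjoint k h a) ∈ M.toSubalgebra),
    ((map_rightAdjoint A.inclBialgHom h a).symm ▸ (hM h a ha).2 :
      A.inclBialgHom (rightAdjoint k h a) ∈ M.toSubalgebra)⟩

theorem inf_eq_bot_or_le_of_isSimple {M A : HopfSubalgebra k H} (hM : M.IsNormal)
    (hA : IsSimpleHopfAlgebra k A.toSubalgebra) :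
    A.toSubalgebra ⊓ M.toSubalgebra = ⊥ ∨ A.toSubalgebra ≤ M.toSubalgebra := by
  refine (hA.2 _ (hM.restrict A)).imp (fun h ↦ ?_) fun h x hx ↦ ?_
  · refine eq_bot_iff.2 fun x hx ↦ ?_
    have mem_bot : (⟨x, hx.1⟩ : A.toSubalgebra) ∈ (⊥ : Subalgebra k A.toSubalgebra) :=
      h ▸ hx.2
    obtain ⟨c, hc⟩ := Algebra.mem_bot.1 mem_bot
    exact ⟨c, congrArg Subtype.val hc⟩
  · exact h.ge (Algebra.mem_top : (⟨x, hx⟩ : A.toSubalgebra) ∈ _)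

end Functoriality

end HopfSubalgebra

namespace HopfSubalgebra

variable {k H : Type*} [Field k] [Ring H] [HopfAlgebra k H] {A B : HopfSubalgebra k H}

theorem leftContract_comp_mulRight_comp_incl {l : H →ₗ[k] k}
    (hl : IsRightCointegral l)
    (h : A.toSubalgebra ⊓ B.toSubalgebra = ⊥) (a : A.toSubalgebra) (b : B.toSubalgebra) :
    leftContract (l ∘ₗ LinearMap.mulRight k (b : H) ∘ₗ A.incl) a =
      algebraMap k A.toSubalgebra (l (a * b)) := by
  have leftContract_coe : (leftContract (l ∘ₗ LinearMap.mulRight k (b : H) ∘ₗ A.incl) a : H) =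
      leftContract (l ∘ₗ LinearMap.mulRight k (b : H)) (a : H) := by
    rw [leftContract_eq_sum (ℛ k a)]
    refine Eq.trans ?_ (leftContract_eq_sum ((ℛ k a).induced A.inclBialgHom) _).symm
    simp [incl_apply]
  have mem_right : leftContract (l ∘ₗ LinearMap.mulRight k (b : H)) (a : H) ∈ B.toSubalgebra :=
    (hl.leftContract_comp_mulRight (a : H) ((ℛ k b).induced B.inclBialgHom)).symm ▸
      sum_mem fun j _ ↦ Subalgebra.smul_mem _ (B.antipode_mem' _ ((ℛ k b).right j).2) _
  have mem_bot : (leftContract (l ∘ₗ LinearMap.mulRight k (b : H) ∘ₗ A.incl) a : H) ∈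
      (⊥ : Subalgebra k H) :=
    h ▸ ⟨Subtype.property _, leftContract_coe ▸ mem_right⟩
  refine Subtype.ext ((eq_algebraMap_counit_of_mem_bot mem_bot).trans ?_)
  rw [leftContract_coe, counit_leftContract]
  rfl

/-- `A` and `B` commute elementwise, intersect trivially and generate `H`; when `H` is finite
dimensional this says that `H` is the internal tensor product of `A` and `B`. -/
structure IsTensorPair (A B : HopfSubalgebra k H) : Prop where
  commute : ∀ (a : A.toSubalgebra) (b : B.toSubalgebra), Commute (a : H) (b : H)
  inf_eq_bot : A.toSubalgebra ⊓ B.toSubalgebra = ⊥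
  sup_eq_top : A.toSubalgebra ⊔ B.toSubalgebra = ⊤

namespace IsTensorPair

theorem symm (h : IsTensorPair A B) : IsTensorPair B A :=
  ⟨fun b a ↦ (h.commute a b).symm, inf_comm A.toSubalgebra _ ▸ h.inf_eq_bot,
    sup_comm A.toSubalgebra _ ▸ h.sup_eq_top⟩

/-- The multiplication map `A ⊗ B → H`. -/
noncomputable def mulHom (h : IsTensorPair A B) : A.toSubalgebra ⊗[k] B.toSubalgebra →ₐc[k] H where
  toCoalgHom := (Bialgebra.mulCoalgHom k H).comp
    (Coalgebra.TensorProduct.map (A.inclBialgHom : A.toSubalgebra →ₗc[k] H)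
      (B.inclBialgHom : B.toSubalgebra →ₗc[k] H))
  map_one' := by simp [Algebra.TensorProduct.one_def]
  map_mul' x y := by
    have eq_lift : LinearMap.mul' k H ∘ₗ TensorProduct.map A.incl B.incl =
        (Algebra.TensorProduct.lift A.toSubalgebra.val B.toSubalgebra.val h.commute).toLinearMap :=
      TensorProduct.ext' fun a b ↦
        (Algebra.TensorProduct.lift_tmul A.toSubalgebra.val B.toSubalgebra.val h.commute a b).symm
    change (LinearMap.mul' k H ∘ₗ TensorProduct.map A.incl B.incl) (x * y) =
      (LinearMap.mul' k H ∘ₗ TensorProduct.map A.incl B.incl) x *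
        (LinearMap.mul' k H ∘ₗ TensorProduct.map A.incl B.incl) y
    rw [eq_lift]
    exact map_mul (Algebra.TensorProduct.lift A.toSubalgebra.val B.toSubalgebra.val h.commute) x y

@[simp]
theorem mulHom_tmul (h : IsTensorPair A B) (a : A.toSubalgebra) (b : B.toSubalgebra) :
    h.mulHom (a ⊗ₜ b) = a * b := rfl

theorem mulHom_surjective (h : IsTensorPair A B) : Function.Surjective h.mulHom := by
  have le_range : A.toSubalgebra ⊔ B.toSubalgebra ≤ h.mulHom.toAlgHom.range :=
    sup_le (fun a ha ↦ ⟨⟨a, ha⟩ ⊗ₜ 1, mul_one a⟩) fun b hb ↦ ⟨1 ⊗ₜ ⟨b, hb⟩, one_mul b⟩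
  rw [h.sup_eq_top] at le_range
  exact fun x ↦ le_range Algebra.mem_top

theorem isRightCointegral_comp_mulHom (h : IsTensorPair A B) {l : H →ₗ[k] k}
    (hl : IsRightCointegral l) :
    IsRightCointegral (l ∘ₗ (h.mulHom : A.toSubalgebra ⊗[k] B.toSubalgebra →ₗ[k] H)) := by
  intro z
  induction z with
  | zero => simp
  | add z w hz hw => rw [map_add, hz, hw, ← map_add, ← map_add]
  | tmul a b =>
    calc leftContract (l ∘ₗ (h.mulHom : A.toSubalgebra ⊗[k] B.toSubalgebra →ₗ[k] H)) (a ⊗ₜ b)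
        = ∑ j ∈ (ℛ k b).index,
            leftContract (l ∘ₗ LinearMap.mulRight k ((ℛ k b).left j : H) ∘ₗ A.incl) a ⊗ₜ[k]
              (ℛ k b).right j := by
          simp only [leftContract_eq_sum ((ℛ k a).tmul (ℛ k b)), leftContract_eq_sum (ℛ k a)]
          simp [Repr.tmul, Finset.sum_product_right, TensorProduct.sum_tmul, incl_apply,
            TensorProduct.smul_tmul']
      _ = 1 ⊗ₜ leftContract (l ∘ₗ LinearMap.mulRight k (a : H) ∘ₗ B.incl) b := by
          simp [leftContract_comp_mulRight_comp_incl hl h.inf_eq_bot, leftContract_eq_sum (ℛ k b),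
            TensorProduct.tmul_sum, (h.commute _ _).eq, Algebra.algebraMap_eq_smul_one,
            TensorProduct.smul_tmul, incl_apply]
      _ = algebraMap k _ (l (h.mulHom (a ⊗ₜ b))) := by
          rw [leftContract_comp_mulRight_comp_incl hl h.symm.inf_eq_bot, mulHom_tmul,
            (h.commute a b).eq]
          simp [Algebra.algebraMap_eq_smul_one, Algebra.TensorProduct.one_def]

theorem mulHom_bijective [Module.Finite k H] (h : IsTensorPair A B) :
    Function.Bijective h.mulHom := by
  obtain ⟨l, hl, hne⟩ := exists_isRightCointegral_ne_zero k H
  exact ⟨injective_of_isRightCointegral_comp _ h.mulHom_surjective hl hne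
    (h.isRightCointegral_comp_mulHom hl), h.mulHom_surjective⟩

theorem isNormal_right (h : IsTensorPair A B) : B.IsNormal := by
  intro x b hb
  obtain ⟨z, rfl⟩ := h.mulHom_surjective x
  induction z generalizing b with
  | zero => simp [leftAdjoint, rightAdjoint]
  | add z w hz hw =>
    simp only [leftAdjoint, rightAdjoint, map_add] at hz hw ⊢
    exact ⟨add_mem (hz b hb).1 (hw b hb).1, add_mem (hz b hb).2 (hw b hb).2⟩
  | tmul a c =>
    have leftAdjoint_eq (y : B.toSubalgebra) :
        leftAdjoint k (a : H) y = counit (R := k) (a : H) • (y : H) :=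
      leftAdjoint_of_commute ((ℛ k a).induced A.inclBialgHom) fun _ ↦ h.commute _ y
    have rightAdjoint_eq (y : B.toSubalgebra) :
        rightAdjoint k (a : H) y = counit (R := k) (a : H) • (y : H) :=
      rightAdjoint_of_commute ((ℛ k a).induced A.inclBialgHom) fun _ ↦ h.commute _ y
    have leftAdjoint_coe := map_leftAdjoint B.inclBialgHom c ⟨b, hb⟩
    have rightAdjoint_coe := map_rightAdjoint B.inclBialgHom c (counit (R := k) (a : H) • ⟨b, hb⟩)
    simp only [inclBialgHom_apply] at leftAdjoint_coe rightAdjoint_coe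
    rw [mulHom_tmul, leftAdjoint_mul, rightAdjoint_mul, rightAdjoint_eq ⟨b, hb⟩,
      ← leftAdjoint_coe, leftAdjoint_eq]
    exact ⟨Subalgebra.smul_mem _ (Subtype.property _) _, rightAdjoint_coe ▸ Subtype.property _⟩

variable [Module.Finite k H] {K : HopfSubalgebra k H}

/-- The multiplication isomorphism `A ⊗ B ≃ H`. -/
noncomputable def mulEquiv (h : IsTensorPair A B) :
    A.toSubalgebra ⊗[k] B.toSubalgebra ≃ₐc[k] H :=
  BialgEquiv.ofBijective h.mulHom h.mulHom_bijective

/-- The projection `a * b ↦ counit a • b`. -/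
noncomputable def projRight (h : IsTensorPair A B) : H →ₐc[k] B.toSubalgebra :=
  (Bialgebra.TensorProduct.lid k B.toSubalgebra : _ →ₐc[k] _).comp
    ((Bialgebra.TensorProduct.map (Bialgebra.counitBialgHom k A.toSubalgebra)
      (BialgHom.id k B.toSubalgebra)).comp (h.mulEquiv.symm : _ →ₐc[k] _))

theorem projRight_mul (h : IsTensorPair A B) (a : A.toSubalgebra) (b : B.toSubalgebra) :
    h.projRight (a * b) = counit (R := k) a • b := by
  have symm_apply : h.mulEquiv.symm (a * b) = a ⊗ₜ[k] b := h.mulEquiv.symm_apply_apply (a ⊗ₜ b)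
  simp [projRight, symm_apply]

theorem projRight_left (h : IsTensorPair A B) (a : A.toSubalgebra) :
    h.projRight a = algebraMap k _ (counit a) := by
  simpa [Algebra.algebraMap_eq_smul_one] using h.projRight_mul a 1

@[simp]
theorem projRight_right (h : IsTensorPair A B) (b : B.toSubalgebra) : h.projRight b = b := by
  simpa using h.projRight_mul 1 b

/-- The projection `a * b ↦ counit b • a`. -/
noncomputable def projLeft (h : IsTensorPair A B) : H →ₐc[k] A.toSubalgebra :=
  h.symm.projRight

theorem projLeft_mul (h : IsTensorPair A B) (a : A.toSubalgebra) (b : B.toSubalgebra) :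
    h.projLeft (a * b) = counit (R := k) b • a := by
  rw [(h.commute a b).eq]
  exact h.symm.projRight_mul b a

theorem projLeft_surjective (h : IsTensorPair A B) : Function.Surjective h.projLeft :=
  fun a ↦ ⟨a, h.symm.projRight_right a⟩

theorem projLeft_convMul_projRight (h : IsTensorPair A B) :
    toConv (A.toSubalgebra.val.comp (h.projLeft : H →ₐ[k] A.toSubalgebra)).toLinearMap *
      toConv (B.toSubalgebra.val.comp (h.projRight : H →ₐ[k] B.toSubalgebra)).toLinearMap =
        toConv LinearMap.id := by
  ext x
  obtain ⟨z, rfl⟩ := h.mulHom_surjective x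
  induction z with
  | zero => simp
  | add z w hz hw => rw [map_add, map_add, map_add, hz, hw]
  | tmul a b =>
    have sum_smul_counit := rightContract_eq_sum (ℛ k a) counit
    rw [rightContract_counit, LinearMap.id_apply] at sum_smul_counit
    rw [(((ℛ k a).tmul (ℛ k b)).induced h.mulHom).convMul_apply]
    conv_rhs => rw [sum_smul_counit, ← sum_counit_smul (ℛ k b)]
    simp [Repr.tmul, projLeft_mul, projRight_mul, Finset.sum_product, Finset.sum_mul_sum,
      smul_comm (counit (R := k) ((ℛ k b).left _))]

theorem sum_projLeft_mul_projRight (h : IsTensorPair A B) {ι : Type*} {x : H} (r : Repr k x ι) :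
    ∑ i ∈ r.index, (h.projLeft (r.left i) * h.projRight (r.right i) : H) = x := by
  simpa [r.convMul_apply] using congr(ofConv $(h.projLeft_convMul_projRight) x)

theorem projLeft_eq_sum (h : IsTensorPair A B) {ι : Type*} {x : H} (r : Repr k x ι) :
    (h.projLeft x : H) =
      ∑ i ∈ r.index, r.left i * (h.projRight (antipode k (r.right i)) : H) := by
  have convMul_eq := congr($(h.projLeft_convMul_projRight) * toConv
    ((B.toSubalgebra.val.comp (h.projRight : H →ₐ[k] B.toSubalgebra)).toLinearMap ∘ₗ antipode k))
  rw [mul_assoc, algHom_convMul_algHom_comp_antipode, mul_one] at convMul_eq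
  simpa [r.convMul_apply] using congr(ofConv $convMul_eq x)

theorem sup_inf_le (h : IsTensorPair A B) {N : Subalgebra k H} (hN : N ≤ B.toSubalgebra) :
    (A.toSubalgebra ⊔ N) ⊓ B.toSubalgebra ≤ N := by
  have sup_le_comap : A.toSubalgebra ⊔ N ≤
      N.comap (B.toSubalgebra.val.comp (h.projRight : H →ₐ[k] B.toSubalgebra)) := by
    refine sup_le (fun a ha ↦ ?_) fun x hx ↦ ?_
    · change (h.projRight a : H) ∈ N
      rw [h.projRight_left ⟨a, ha⟩]
      exact N.algebraMap_mem _
    · change (h.projRight x : H) ∈ N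
      rwa [h.projRight_right ⟨x, hN hx⟩]
  rintro x ⟨hx, hxB⟩
  have projRight_mem : (h.projRight x : H) ∈ N := sup_le_comap hx
  rwa [h.projRight_right ⟨x, hxB⟩] at projRight_mem

theorem finrank_mul_finrank (h : IsTensorPair A B) :
    Module.finrank k A.toSubalgebra * Module.finrank k B.toSubalgebra = Module.finrank k H := by
  rw [← Module.finrank_tensorProduct]
  exact (LinearEquiv.ofBijective (h.mulHom : _ →ₗ[k] H) h.mulHom_bijective).finrank_eq

theorem le_right_of_map_projLeft_eq_bot (h : IsTensorPair A B)
    (hK : (K.map h.projLeft).toSubalgebra = ⊥) : K.toSubalgebra ≤ B.toSubalgebra := by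
  intro x hx
  obtain ⟨r, hr_left, -⟩ := K.exists_repr hx
  rw [← h.sum_projLeft_mul_projRight r]
  refine sum_mem fun i _ ↦ mul_mem ?_ (Subtype.property _)
  obtain ⟨c, hc⟩ := Algebra.mem_bot.1 (hK.le ⟨_, hr_left i, rfl⟩)
  have projLeft_eq : algebraMap k _ c = h.projLeft (r.left i) := hc
  exact projLeft_eq ▸ B.toSubalgebra.algebraMap_mem c

theorem left_le_sup_of_map_projLeft_eq_top (h : IsTensorPair A B)
    (hK : (K.map h.projLeft).toSubalgebra = ⊤) :
    A.toSubalgebra ≤ K.toSubalgebra ⊔ B.toSubalgebra := by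
  intro a ha
  obtain ⟨x, hx, hxa⟩ := hK.ge (Algebra.mem_top : (⟨a, ha⟩ : A.toSubalgebra) ∈ _)
  obtain ⟨r, hr_left, -⟩ := K.exists_repr hx
  have projLeft_eq : (h.projLeft x : H) = a := congrArg Subtype.val hxa
  rw [← projLeft_eq, h.projLeft_eq_sum r]
  exact sum_mem fun i _ ↦ mul_mem (SetLike.le_def.1 le_sup_left (hr_left i))
    (SetLike.le_def.1 le_sup_right (Subtype.property _))

theorem nonempty_equiv_of_map_projLeft_eq_top (h : IsTensorPair A B) (hKB : IsTensorPair K B)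
    (hK : (K.map h.projLeft).toSubalgebra = ⊤) :
    Nonempty (K.toSubalgebra ≃ₐc[k] A.toSubalgebra) := by
  have surjective : Function.Surjective (h.projLeft.comp K.inclBialgHom) := fun a ↦
    let ⟨x, hx, hxa⟩ := hK.ge (Algebra.mem_top : a ∈ _)
    ⟨⟨x, hx⟩, hxa⟩
  have : Nontrivial B.toSubalgebra :=
    nontrivial_of_ne 0 1 fun h01 ↦ by simpa using congr(counit (R := k) $h01)
  have finrank_eq : Module.finrank k K.toSubalgebra = Module.finrank k A.toSubalgebra :=
    Nat.eq_of_mul_eq_mul_right Module.finrank_pos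
      (hKB.finrank_mul_finrank.trans h.finrank_mul_finrank.symm)
  exact ⟨BialgEquiv.ofBijective _ ⟨(LinearMap.injective_iff_surjective_of_finrank_eq_finrank
    (f := (h.projLeft.comp K.inclBialgHom : K.toSubalgebra →ₗ[k] A.toSubalgebra))
      finrank_eq).2 surjective, surjective⟩⟩

theorem exchange (h : IsTensorPair A B) (hA : IsSimpleHopfAlgebra k A.toSubalgebra)
    (hK : IsSimpleHopfAlgebra k K.toSubalgebra) (hKn : K.IsNormal)
    (hKB : ¬ K.toSubalgebra ≤ B.toSubalgebra) :
    IsTensorPair K B ∧ Nonempty (K.toSubalgebra ≃ₐc[k] A.toSubalgebra) := by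
  have inf_eq_bot := (inf_eq_bot_or_le_of_isSimple h.isNormal_right hK).resolve_right hKB
  have map_eq_top : (K.map h.projLeft).toSubalgebra = ⊤ :=
    (hA.2 _ (hKn.map h.projLeft_surjective)).resolve_left fun map_eq_bot ↦
      hKB (h.le_right_of_map_projLeft_eq_bot map_eq_bot)
  have pair : IsTensorPair K B :=
    { commute := commute_of_isNormal hKn h.isNormal_right inf_eq_bot
      inf_eq_bot := inf_eq_bot
      sup_eq_top := eq_top_iff.2 (h.sup_eq_top.ge.trans
        (sup_le (h.left_le_sup_of_map_projLeft_eq_top map_eq_top) le_sup_right)) }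
  exact ⟨pair, h.nonempty_equiv_of_map_projLeft_eq_top pair map_eq_top⟩

end IsTensorPair

end HopfSubalgebra

namespace HopfSubalgebra

variable {k H : Type*} [Field k] [Ring H] [HopfAlgebra k H] {ι κ : Type*}
  {K : ι → HopfSubalgebra k H} {L : κ → HopfSubalgebra k H}

/-- The complement `⟨L j | j ≠ i⟩` of the `i`-th factor. -/
noncomputable def complement (L : κ → HopfSubalgebra k H) (i : κ) : HopfSubalgebra k H :=
  generate fun j : {j : κ // j ≠ i} ↦ L j

theorem le_complement (L : κ → HopfSubalgebra k H) {i j : κ} (h : j ≠ i) :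
    (L j).toSubalgebra ≤ (complement L i).toSubalgebra :=
  le_iSup (fun j : {j : κ // j ≠ i} ↦ (L j).toSubalgebra) ⟨j, h⟩

theorem complement_le {i : κ} {N : Subalgebra k H} (h : ∀ j ≠ i, (L j).toSubalgebra ≤ N) :
    (complement L i).toSubalgebra ≤ N :=
  iSup_le fun j ↦ h j j.2

namespace IsInternalTensorProduct

theorem not_le_complement (hL : IsInternalTensorProduct L) {i : κ}
    (hi : (L i).toSubalgebra ≠ ⊥) : ¬ (L i).toSubalgebra ≤ (complement L i).toSubalgebra :=
  fun h ↦ hi ((inf_eq_left.2 h).symm.trans (hL.inf_eq_bot i))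

theorem injective (hL : IsInternalTensorProduct L) (hne : ∀ i, (L i).toSubalgebra ≠ ⊥) :
    Function.Injective L := by
  intro i j hij
  by_contra hne_ij
  exact hL.not_le_complement (hne j) (hij ▸ le_complement L hne_ij)

theorem isTensorPair (hL : IsInternalTensorProduct L) (i : κ) :
    IsTensorPair (L i) (complement L i) where
  commute a b := by
    have le_centralizer : (complement L i).toSubalgebra ≤ Subalgebra.centralizer k {(a : H)} := by
      refine complement_le fun j hj b hb ↦ (Subalgebra.mem_centralizer_iff k).2 ?_
      rintro _ rfl
      have inf_eq_bot : (L i).toSubalgebra ⊓ (L j).toSubalgebra = ⊥ :=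
        eq_bot_iff.2 ((inf_le_inf_left _ (le_complement L hj)).trans (hL.inf_eq_bot i).le)
      exact commute_of_isNormal (hL.normal i) (hL.normal j) inf_eq_bot a ⟨b, hb⟩
    exact (Subalgebra.mem_centralizer_iff k).1 (le_centralizer b.2) a rfl
  inf_eq_bot := hL.inf_eq_bot i
  sup_eq_top := eq_top_iff.2 <| hL.generate_eq_top.ge.trans <| iSup_le fun j ↦ by
    obtain rfl | hj := eq_or_ne j i
    · exact le_sup_left
    · exact le_sup_of_le_right (le_complement L hj)

variable [Module.Finite k H]

theorem iInf_complement_le_iSup (hL : IsInternalTensorProduct L) (U : Finset κ) :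
    ⨅ i ∈ U, (complement L i).toSubalgebra ≤ ⨆ j ∉ U, (L j).toSubalgebra := by
  classical
  induction U using Finset.induction_on with
  | empty => simpa [generate] using hL.generate_eq_top
  | insert i U _ ih =>
    have iSup_le_complement :
        ⨆ j ∉ insert i U, (L j).toSubalgebra ≤ (complement L i).toSubalgebra :=
      iSup₂_le fun j hj ↦ le_complement L fun hji ↦ hj (hji ▸ Finset.mem_insert_self i U)
    have iSup_le_sup : ⨆ j ∉ U, (L j).toSubalgebra ≤
        (L i).toSubalgebra ⊔ ⨆ j ∉ insert i U, (L j).toSubalgebra := by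
      refine iSup₂_le fun j hj ↦ ?_
      obtain rfl | hji := eq_or_ne j i
      · exact le_sup_left
      · exact le_sup_of_le_right (le_iSup₂_of_le j (by simp [hji, hj]) le_rfl)
    calc ⨅ j ∈ insert i U, (complement L j).toSubalgebra
        = (⨅ j ∈ U, (complement L j).toSubalgebra) ⊓ (complement L i).toSubalgebra := by
          rw [Finset.iInf_insert, inf_comm]
      _ ≤ ((L i).toSubalgebra ⊔ ⨆ j ∉ insert i U, (L j).toSubalgebra) ⊓
            (complement L i).toSubalgebra := inf_le_inf_right _ (ih.trans iSup_le_sup)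
      _ ≤ ⨆ j ∉ insert i U, (L j).toSubalgebra :=
          (hL.isTensorPair i).sup_inf_le iSup_le_complement

theorem update [DecidableEq κ] (hL : IsInternalTensorProduct L) {A : HopfSubalgebra k H} {j : κ}
    (hA : A.IsNormal) (h : IsTensorPair A (complement L j)) :
    IsInternalTensorProduct (Function.update L j A) where
  normal := (Function.forall_update_iff L fun _ B ↦ B.IsNormal).2 ⟨hA, fun i _ ↦ hL.normal i⟩
  generate_eq_top := by
    refine eq_top_iff.2 (h.sup_eq_top.ge.trans (sup_le ?_ (complement_le fun i hi ↦ ?_)))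
    · exact le_iSup_of_le j (by rw [Function.update_self])
    · exact le_iSup_of_le i (by rw [Function.update_of_ne hi])
  inf_eq_bot i := by
    change _ ⊓ (complement (Function.update L j A) i).toSubalgebra = ⊥
    refine eq_bot_iff.2 ?_
    obtain rfl | hij := eq_or_ne i j
    · refine le_trans (inf_le_inf (by rw [Function.update_self]) (complement_le fun l hl ↦ ?_))
        h.inf_eq_bot.le
      rw [Function.update_of_ne hl]
      exact le_complement L hl
    · rw [Function.update_of_ne hij]
      let N := (complement L i).toSubalgebra ⊓ (complement L j).toSubalgebra
      have complement_update_le :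
          (complement (Function.update L j A) i).toSubalgebra ≤ A.toSubalgebra ⊔ N := by
        refine complement_le fun l hl ↦ ?_
        obtain rfl | hlj := eq_or_ne l j
        · rw [Function.update_self]
          exact le_sup_left
        · rw [Function.update_of_ne hlj]
          exact le_sup_of_le_right (le_inf (le_complement L hl) (le_complement L hlj))
      calc (L i).toSubalgebra ⊓ (complement (Function.update L j A) i).toSubalgebra
          ≤ (L i).toSubalgebra ⊓ ((A.toSubalgebra ⊔ N) ⊓ (complement L j).toSubalgebra) :=
            le_inf inf_le_left
              (le_inf (inf_le_right.trans complement_update_le)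
                (inf_le_left.trans (le_complement L hij)))
        _ ≤ (L i).toSubalgebra ⊓ N := inf_le_inf_left _ (h.sup_inf_le inf_le_right)
        _ ≤ (L i).toSubalgebra ⊓ (complement L i).toSubalgebra := inf_le_inf_left _ inf_le_left
        _ ≤ ⊥ := (hL.inf_eq_bot i).le

theorem exists_not_le_complement [Finite κ] (hK : IsInternalTensorProduct K)
    (hL : IsInternalTensorProduct L) {i : ι} (hi : (K i).toSubalgebra ≠ ⊥) :
    ∃ j, (∀ i' ≠ i, L j ≠ K i') ∧ ¬ (K i).toSubalgebra ≤ (complement L j).toSubalgebra := by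
  classical
  have := Fintype.ofFinite κ
  by_contra! h
  refine hK.not_le_complement hi ?_
  let U : Finset κ := {j | ∀ i' ≠ i, L j ≠ K i'}
  calc (K i).toSubalgebra
      ≤ ⨅ j ∈ U, (complement L j).toSubalgebra :=
        le_iInf₂ fun j hj ↦ h j (Finset.mem_filter_univ j |>.1 hj)
    _ ≤ ⨆ j ∉ U, (L j).toSubalgebra := hL.iInf_complement_le_iSup U
    _ ≤ (complement K i).toSubalgebra := iSup₂_le fun j hj ↦ by
        obtain ⟨i', hi', hij⟩ : ∃ i' ≠ i, L j = K i' := by simpa [U] using hj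
        exact hij ▸ le_complement K hi'

end IsInternalTensorProduct

theorem toSubalgebra_ne_bot_of_isSimple {A : HopfSubalgebra k H}
    (hA : IsSimpleHopfAlgebra k A.toSubalgebra) : A.toSubalgebra ≠ ⊥ := by
  refine fun h ↦ hA.1 (eq_bot_iff.2 fun x _ ↦ ?_)
  obtain ⟨c, hc⟩ := Algebra.mem_bot.1 (h.le x.2)
  exact Algebra.mem_bot.2 ⟨c, Subtype.ext hc⟩

variable [Module.Finite k H]

theorem exists_isInternalTensorProduct_exchange [Finite κ] (hK : IsInternalTensorProduct K)
    (hL : IsInternalTensorProduct L) (hKs : ∀ i, IsSimpleHopfAlgebra k (K i).toSubalgebra)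
    (hLs : ∀ j, IsSimpleHopfAlgebra k (L j).toSubalgebra) (I : Finset ι) :
    ∃ L' : κ → HopfSubalgebra k H, IsInternalTensorProduct L' ∧
      (∀ j, IsSimpleHopfAlgebra k (L' j).toSubalgebra ∧
        Nonempty ((L' j).toSubalgebra ≃ₐc[k] (L j).toSubalgebra)) ∧
      ∀ i ∈ I, ∃ j, L' j = K i := by
  classical
  induction I using Finset.induction_on with
  | empty => exact ⟨L, hL, fun j ↦ ⟨hLs j, ⟨BialgEquiv.refl k _⟩⟩, by simp⟩
  | insert i I hi ih =>
    obtain ⟨L', hL', hL's, hL'K⟩ := ih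
    obtain ⟨j, hj_ne, hj⟩ :=
      hK.exists_not_le_complement hL' (toSubalgebra_ne_bot_of_isSimple (hKs i))
    obtain ⟨pair, ⟨e⟩⟩ :=
      (hL'.isTensorPair j).exchange (hL's j).1 (hKs i) (hK.normal i) hj
    obtain ⟨f⟩ := (hL's j).2
    refine ⟨Function.update L' j (K i), hL'.update (hK.normal i) pair,
      (Function.forall_update_iff L' fun l B ↦ IsSimpleHopfAlgebra k B.toSubalgebra ∧
        Nonempty (B.toSubalgebra ≃ₐc[k] (L l).toSubalgebra)).2
        ⟨⟨hKs i, ⟨e.trans f⟩⟩, fun l _ ↦ hL's l⟩,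
      (Finset.forall_mem_insert ..).2 ⟨⟨j, Function.update_self ..⟩, fun i' hi' ↦ ?_⟩⟩
    obtain ⟨j', hj'⟩ := hL'K i' hi'
    have j'_ne : j' ≠ j := fun h ↦ hj_ne i' (ne_of_mem_of_not_mem hi' hi) (h ▸ hj')
    exact ⟨j', (Function.update_of_ne j'_ne ..).trans hj'⟩

theorem exists_injective_equiv [Finite ι] [Finite κ] (hK : IsInternalTensorProduct K)
    (hL : IsInternalTensorProduct L) (hKs : ∀ i, IsSimpleHopfAlgebra k (K i).toSubalgebra)
    (hLs : ∀ j, IsSimpleHopfAlgebra k (L j).toSubalgebra) :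
    ∃ σ : ι → κ, Function.Injective σ ∧
      ∀ i, Nonempty ((K i).toSubalgebra ≃ₐc[k] (L (σ i)).toSubalgebra) := by
  have := Fintype.ofFinite ι
  obtain ⟨L', -, hL's, hL'K⟩ :=
    exists_isInternalTensorProduct_exchange hK hL hKs hLs Finset.univ
  choose σ hσ using fun i ↦ hL'K i (Finset.mem_univ i)
  have injective : Function.Injective (L' ∘ σ) :=
    (funext hσ : L' ∘ σ = K) ▸ hK.injective fun i ↦ toSubalgebra_ne_bot_of_isSimple (hKs i)
  exact ⟨σ, injective.of_comp, fun i ↦ hσ i ▸ (hL's (σ i)).2⟩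

end HopfSubalgebra

open HopfSubalgebra in
theorem corollary4p6_general {k H : Type*} [Field k] [Ring H] [HopfAlgebra k H]
    [Module.Finite k H] {ι κ : Type*} [Finite ι] [Finite κ]
    {K : ι → HopfSubalgebra k H} {L : κ → HopfSubalgebra k H}
    (hK : IsInternalTensorProduct K) (hL : IsInternalTensorProduct L)
    (hKs : ∀ i, IsSimpleHopfAlgebra k (K i).toSubalgebra)
    (hLs : ∀ j, IsSimpleHopfAlgebra k (L j).toSubalgebra) :
    ∃ σ : ι ≃ κ, ∀ i, Nonempty ((K i).toSubalgebra ≃ₐc[k] (L (σ i)).toSubalgebra) := by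
  obtain ⟨σ, σ_injective, hσ⟩ := exists_injective_equiv hK hL hKs hLs
  obtain ⟨τ, τ_injective, -⟩ := exists_injective_equiv hL hK hLs hKs
  exact ⟨.ofBijective σ (σ_injective.bijective_of_nat_card_le
    (Nat.card_le_card_of_injective τ τ_injective)), hσ⟩

theorem corollary4p6 {k H : Type*} [Field k] [IsAlgClosed k] [CharZero k]
    [Ring H] [HopfAlgebra k H] [Module.Finite k H] [IsSemisimpleRing H]
    {r s : ℕ} (K : Fin r → HopfSubalgebra k H) (L : Fin s → HopfSubalgebra k H)
    (hK : IsKrullSchmidtRemakDecomposition K) (hL : IsKrullSchmidtRemakDecomposition L) :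
    ∃ h : r = s, ∃ σ : Equiv.Perm (Fin r), ∀ i : Fin r,
      Nonempty ((K i).toSubalgebra ≃ₐc[k] (L (Fin.cast h (σ i))).toSubalgebra) := by
  obtain ⟨σ, hσ⟩ := corollary4p6_general hK.internal hL.internal hK.simple hL.simple
  obtain rfl : r = s := Fin.equiv_iff_eq.1 ⟨σ⟩
  exact ⟨rfl, σ, hσ⟩
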